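/- Fix partially ordered sets $A_P$ and $A_T$ of place names and transition names, each with a greatest element. A (marked, labelled place/transition) net is $N=(P,T,pre,post,p_l,t_l,m)$ with sets $P,T$, maps $pre,post:T\to P^\oplus$ into the free commutative monoid over $P$, labellings $p_l:P\to A_P$, $t_l:T\to A_T$ and a marking $m\in P^\oplus$. A net morphism $f=(f_P,f_T):N_1\to N_2$ satisfies $pre_2\circ f_T=f_P^\oplus\circ pre_1$, $post_2\circ f_T=f_P^\oplus\circ post_1$, $p_{l,2}(f_P(p))\le p_{l,1}(p)$, $t_{l,2}(f_T(t))\le t_{l,1}(t)$ and $m_1(p)\le m_2(f_P(p))$. It is strict if $f_P,f_T$ are injective and the last three relations are equalities. A rule is a span $L\leftarrow K\to R$ of strict morphisms. It is applied at an occurrence $o:L\to N$ by a double pushout in the category of nets, i.e. by a net $D$ with morphisms $K\to D$, $D\to N$, $D\to M$ such that $N$ is the pushout of $L\leftarrow K\to D$ (with $o:L\to N$) and $M$ is the pushout of $R\leftarrow K\to D$; one writes $N\Rightarrow M$. If a second occurrence $o':L'\to N$ of a rule factors as $L'\xrightarrow{g}D\to N$, its residual in $M$ is $L'\xrightarrow{g}D\to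 M$. For a transition $t$ of $N$ let $Net(t)$ be the net consisting of $t$ and its adjacent places ${}^\bullet t\cup t^\bullet$, and let $CP(t)$ be the net consisting of these places only, both with the labels and the marking of $N$ restricted. A reconfigurable net with substitutions $RN=(N,\mathcal R^N,SR^N)$ over a local name space $(A_P^N,A_T^N)$ (subsets of $A_P$ and $A_T$ that contain the greatest elements) is defined recursively. It consists of - a net $N$ with labels in $(A_P^N,A_T^N)$ and a set $sT\subseteq T$ of substitution transitions, with distinguished subsets $A_{sT}\subseteq A_T^N$ and $A_{cP}\subseteq A_P^N$ such that $t_l$ is injective on $sT$, $t_l(sT)\subseteq A_{sT}$, $t_l(T\setminus sT)\subseteq A_T^N\setminus A_{sT}$, and the places adjacent to substitution transitions have labels in $A_{cP}$; - a set $\mathcal R^N$ of local rules over $(A_P^N,A_T^N\setminus A_{sT})$; - for every $t\in sT$ a substitution rule $subst(t)=(Net(t)\leftarrow CP(t)\to SN^t)$, where $CP(t)\to Net(t)$ is the inclusion, $CP(t)\to SN^t$ is strict, and $SN^t$ is (the net of) a reconfigurable net with substitutions over a local name space whose place names include $A_{cP}$. The set of substitutions is $S^N=\{(subst(t),\,Net(t)\hookrightarrow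 N)\mid t\in sT\}$, one for each $t\in sT$, the occurrence being the inclusion. A transformation sequence of $S^N$ is a sequence of transformation steps starting at $N$ that applies the elements of $S^N$ in some order, each at the residual of its occurrence along the preceding steps. **Theorem.** Let $RN=(N,\mathcal R^N,SR^N)$ be a reconfigurable net with substitutions such that $sT$ is finite. Then there is a net $FLAT(N,SR^N)$, unique up to isomorphism, such that 1. for every ordering of $S^N$ there is a transformation sequence from $N$ to $FLAT(N,SR^N)$ that applies the elements of $S^N$ in this order; 2. every transformation sequence that applies all elements of $S^N$ ends in a net isomorphic to $FLAT(N,SR^N)$; 3. the parallel rule $\sum_{t\in sT}subst(t)$, i.e. the coproduct of the substitution rules, applied at the occurrence induced by the inclusions $Net(t)\hookrightarrow N$, transforms $N$ into $FLAT(N,SR^N)$, and every net that it yields at this occurrence is isomorphic to $FLAT(N,SR^N)$. -/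

import Mathlib

open CategoryTheory

universe u v w

/-- A marked labelled place/transition net over the alphabet `(AP, AT)`. The free commutative
monoid `P^⊕` is `P →₀ ℕ`. -/
structure PTNet (AP : Type v) (AT : Type w) where
  P : Type u
  T : Type u
  pre : T → P →₀ ℕ
  post : T → P →₀ ℕ
  pname : P → AP
  tname : T → AT
  marking : P →₀ ℕ

namespace PTNet

variable {AP : Type v} {AT : Type w} [PartialOrder AP] [PartialOrder AT]

/-- Net morphisms: they preserve pre- and post-domains, may increase the marking, and may
replace a label by a smaller one. -/
@[ext]
structure Hom (N M : PTNet.{u} AP AT) where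
  fP : N.P → M.P
  fT : N.T → M.T
  pre_comm : ∀ t, M.pre (fT t) = Finsupp.mapDomain fP (N.pre t)
  post_comm : ∀ t, M.post (fT t) = Finsupp.mapDomain fP (N.post t)
  pname_le : ∀ p, M.pname (fP p) ≤ N.pname p
  tname_le : ∀ t, M.tname (fT t) ≤ N.tname t
  marking_le : ∀ p, N.marking p ≤ M.marking (fP p)

instance : Category (PTNet.{u} AP AT) where
  Hom := Hom
  id N :=
    { fP := id
      fT := id
      pre_comm := fun t => by simp
      post_comm := fun t => by simp
      pname_le := fun _ => le_rfl
      tname_le := fun _ => le_rfl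
      marking_le := fun _ => le_rfl }
  comp f g :=
    { fP := g.fP ∘ f.fP
      fT := g.fT ∘ f.fT
      pre_comm := fun t => by
        rw [Function.comp_apply, g.pre_comm, f.pre_comm, Finsupp.mapDomain_comp]
      post_comm := fun t => by
        rw [Function.comp_apply, g.post_comm, f.post_comm, Finsupp.mapDomain_comp]
      pname_le := fun p => (g.pname_le _).trans (f.pname_le p)
      tname_le := fun t => (g.tname_le _).trans (f.tname_le t)
      marking_le := fun p => (f.marking_le p).trans (g.marking_le _) }

/-- Strict morphisms: injective, label preserving and marking preserving. -/
structure IsStrict {N M : PTNet.{u} AP AT} (f : N ⟶ M) : Prop where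
  injP : Function.Injective (Hom.fP f)
  injT : Function.Injective (Hom.fT f)
  pname_eq : ∀ p, M.pname (Hom.fP f p) = N.pname p
  tname_eq : ∀ t, M.tname (Hom.fT f t) = N.tname t
  marking_eq : ∀ p, N.marking p = M.marking (Hom.fP f p)

/-- The neighbourhood `•t ∪ t•` of a transition. -/
def conn (N : PTNet.{u} AP AT) (t : N.T) : Set N.P :=
  {p | N.pre t p ≠ 0 ∨ N.post t p ≠ 0}

/-- `Net(t)`: the transition `t` together with its adjacent places, with restricted labels and
marking. -/
noncomputable def netOf (N : PTNet.{u} AP AT) (t : N.T) : PTNet.{u} AP AT where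
  P := N.conn t
  T := PUnit
  pre := fun _ => (N.pre t).subtypeDomain (· ∈ N.conn t)
  post := fun _ => (N.post t).subtypeDomain (· ∈ N.conn t)
  pname := fun p => N.pname p
  tname := fun _ => N.tname t
  marking := N.marking.subtypeDomain (· ∈ N.conn t)

/-- `CP(t)`: the places adjacent to `t`, with restricted labels and marking, no transitions. -/
noncomputable def cpOf (N : PTNet.{u} AP AT) (t : N.T) : PTNet.{u} AP AT where
  P := N.conn t
  T := PEmpty
  pre := PEmpty.elim
  post := PEmpty.elim
  pname := fun p => N.pname p
  tname := PEmpty.elim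
  marking := N.marking.subtypeDomain (· ∈ N.conn t)

/-- The inclusion `CP(t) → Net(t)`. -/
noncomputable def cpToNet (N : PTNet.{u} AP AT) (t : N.T) : N.cpOf t ⟶ N.netOf t :=
  ({ fP := fun p => p
     fT := PEmpty.elim
     pre_comm := fun x => PEmpty.elim x
     post_comm := fun x => PEmpty.elim x
     pname_le := fun _ => le_rfl
     tname_le := fun x => PEmpty.elim x
     marking_le := fun _ => le_rfl } : Hom (N.cpOf t) (N.netOf t))

theorem cpToNet_isStrict (N : PTNet.{u} AP AT) (t : N.T) : IsStrict (N.cpToNet t) where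
  injP := fun _ _ h => h
  injT := fun x => PEmpty.elim x
  pname_eq := fun _ => rfl
  tname_eq := fun x => PEmpty.elim x
  marking_eq := fun _ => rfl

theorem mapDomain_restrict {α : Type u} (s : Set α) (m : α →₀ ℕ) (h : ∀ a, m a ≠ 0 → a ∈ s) :
    Finsupp.mapDomain (Subtype.val : s → α) (m.subtypeDomain (· ∈ s)) = m := by
  ext a
  by_cases ha : a ∈ s
  · exact Finsupp.mapDomain_apply Subtype.val_injective _ (⟨a, ha⟩ : s)
  · rw [Finsupp.mapDomain_of_notMem_range _ _ (by simpa using ha)]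
    by_contra hne
    exact ha (h a (Ne.symm hne))

/-- The inclusion `Net(t) → N`. -/
noncomputable def netIncl (N : PTNet.{u} AP AT) (t : N.T) : N.netOf t ⟶ N :=
  ({ fP := Subtype.val
     fT := fun _ => t
     pre_comm := fun _ => (mapDomain_restrict _ _ fun _ h => Or.inl h).symm
     post_comm := fun _ => (mapDomain_restrict _ _ fun _ h => Or.inr h).symm
     pname_le := fun _ => le_rfl
     tname_le := fun _ => le_rfl
     marking_le := fun _ => le_rfl } : Hom (N.netOf t) N)

/-- A rule `L ← K → R`: a span of strict morphisms. -/
structure Rule (AP : Type v) (AT : Type w) [PartialOrder AP] [PartialOrder AT] where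
  L : PTNet.{u} AP AT
  K : PTNet.{u} AP AT
  R : PTNet.{u} AP AT
  l : K ⟶ L
  r : K ⟶ R
  l_strict : IsStrict l
  r_strict : IsStrict r

/-- A net has all its labels in the given sets of names. -/
def IsOver (N : PTNet.{u} AP AT) (SP : Set AP) (ST : Set AT) : Prop :=
  (∀ p, N.pname p ∈ SP) ∧ ∀ t, N.tname t ∈ ST

/-- A rule has all its labels in the given sets of names. -/
def Rule.IsOver (ρ : Rule.{u} AP AT) (SP : Set AP) (ST : Set AT) : Prop :=
  ρ.L.IsOver SP ST ∧ ρ.K.IsOver SP ST ∧ ρ.R.IsOver SP ST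

/-- A double-pushout transformation step `N ⇒ M` by the rule `ρ` at the occurrence `o`. -/
structure Step (ρ : Rule.{u} AP AT) {N : PTNet.{u} AP AT} (o : ρ.L ⟶ N)
    (M : PTNet.{u} AP AT) where
  D : PTNet.{u} AP AT
  k : ρ.K ⟶ D
  toN : D ⟶ N
  n : ρ.R ⟶ M
  toM : D ⟶ M
  po₁ : IsPushout ρ.l k o toN
  po₂ : IsPushout ρ.r k n toM

/-- A rule together with an occurrence in `N`. -/
structure Match (N : PTNet.{u} AP AT) where
  rule : Rule.{u} AP AT
  occ : rule.L ⟶ N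

/-- `s'` is the residual in `M` of the match `s` in `N` along a step `N ← D → M`: the
occurrence of `s` factors through `D`, and that of `s'` is the factorization followed by
`D → M`. -/
def IsResidual {ρ : Rule.{u} AP AT} {N M : PTNet.{u} AP AT} {o : ρ.L ⟶ N}
    (d : Step ρ o M) (s : Match N) (s' : Match M) : Prop :=
  ∃ g : s.rule.L ⟶ d.D, g ≫ d.toN = s.occ ∧ s' = ⟨s.rule, g ≫ d.toM⟩

/-- `TransSeq N l F`: there is a transformation sequence from `N` to `F` that applies the matches
in the list `l` one after the other, each later one at its residual occurrence. As usual, a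
sequence of length zero is an isomorphism. -/
inductive TransSeq : (N : PTNet.{u} AP AT) → List (Match N) → PTNet.{u} AP AT → Prop
  | nil {N F : PTNet.{u} AP AT} (e : N ≅ F) : TransSeq N [] F
  | cons {N M F : PTNet.{u} AP AT} (s : Match N) (rest : List (Match N))
      (d : Step s.rule s.occ M) (rest' : List (Match M))
      (hres : List.Forall₂ (IsResidual d) rest rest')
      (tail : TransSeq M rest' F) : TransSeq N (s :: rest) F

/-- `ρ` is a parallel rule `∑ i, σ i`: its three nets and two morphisms are the coproducts of
those of the `σ i`. -/
structure ParallelRule {ι : Type u} (σ : ι → Rule.{u} AP AT) where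
  rule : Rule.{u} AP AT
  inL : ∀ i, (σ i).L ⟶ rule.L
  inK : ∀ i, (σ i).K ⟶ rule.K
  inR : ∀ i, (σ i).R ⟶ rule.R
  comm_l : ∀ i, inK i ≫ rule.l = (σ i).l ≫ inL i
  comm_r : ∀ i, inK i ≫ rule.r = (σ i).r ≫ inR i
  isColimitL : Limits.IsColimit (Limits.Cofan.mk rule.L inL)
  isColimitK : Limits.IsColimit (Limits.Cofan.mk rule.K inK)
  isColimitR : Limits.IsColimit (Limits.Cofan.mk rule.R inR)

/-- `N ⇒ F` by one application of a parallel rule of the family `s`, at the occurrence induced by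
the occurrences of the members of the family. -/
def ParallelStep {ι : Type u} {N : PTNet.{u} AP AT} (s : ι → Match N)
    (F : PTNet.{u} AP AT) : Prop :=
  ∃ (ρ : ParallelRule fun i => (s i).rule) (o : ρ.rule.L ⟶ N),
    (∀ i, ρ.inL i ≫ o = (s i).occ) ∧ Nonempty (Step ρ.rule o F)

end PTNet

/-- A local name space inside the global one: subsets of place names and of transition names
containing the greatest elements, with the induced orders. -/
structure NameSpace (AP : Type v) (AT : Type w) [PartialOrder AP] [PartialOrder AT]
    [OrderTop AP] [OrderTop AT] where
  P : Set AP
  T : Set AT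
  top_mem_P : ⊤ ∈ P
  top_mem_T : ⊤ ∈ T

/-- One level of a reconfigurable net with substitutions: the net `N` over the name space `A`, its
substitution transitions, its local rules, and, for each substitution transition `t`, the net of
`SN^t` with its name space and the embedding of the connecting places. -/
structure SubstLevel {AP : Type v} {AT : Type w} [PartialOrder AP] [PartialOrder AT]
    [OrderTop AP] [OrderTop AT] (A : NameSpace AP AT) (N : PTNet.{u} AP AT) where
  isOver : N.IsOver A.P A.T
  /-- substitution transitions -/
  sT : Set N.T
  /-- names of substitution transitions -/
  AsT : Set AT
  AsT_subset : AsT ⊆ A.T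
  tname_mem : ∀ t ∈ sT, N.tname t ∈ AsT
  tname_injOn : Set.InjOn N.tname sT
  tname_notMem : ∀ t, t ∉ sT → N.tname t ∉ AsT
  /-- names of connecting places -/
  AcP : Set AP
  AcP_subset : AcP ⊆ A.P
  pname_mem : ∀ t ∈ sT, ∀ p ∈ N.conn t, N.pname p ∈ AcP
  /-- local rules -/
  rules : Set (PTNet.Rule.{u} AP AT)
  rules_over : ∀ ρ ∈ rules, ρ.IsOver A.P (A.T \ AsT)
  /-- name spaces of the subnets -/
  subA : sT → NameSpace AP AT
  AcP_subset_subA : ∀ t, AcP ⊆ (subA t).P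
  /-- subnets -/
  subNet : sT → PTNet.{u} AP AT
  /-- connecting places of the subnets -/
  emb : ∀ t : sT, N.cpOf t.1 ⟶ subNet t
  emb_strict : ∀ t, PTNet.IsStrict (emb t)

/-- Reconfigurable nets with substitutions: all the subnets `SN^t` are again reconfigurable nets
with substitutions. -/
inductive ReconfNet {AP : Type v} {AT : Type w} [PartialOrder AP] [PartialOrder AT]
    [OrderTop AP] [OrderTop AT] :
    NameSpace AP AT → PTNet.{u} AP AT → Type (max (u + 1) v w)
  | mk {A : NameSpace AP AT} {N : PTNet.{u} AP AT} (level : SubstLevel A N)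
      (sub : ∀ t : level.sT, ReconfNet (level.subA t) (level.subNet t)) : ReconfNet A N

namespace ReconfNet

variable {AP : Type v} {AT : Type w} [PartialOrder AP] [PartialOrder AT]
  [OrderTop AP] [OrderTop AT] {A : NameSpace AP AT} {N : PTNet.{u} AP AT}

/-- The top level of the hierarchy. -/
def level : ReconfNet A N → SubstLevel A N
  | mk lv _ => lv

/-- The set `sT` of substitution transitions. -/
def sT (RN : ReconfNet A N) : Set N.T := RN.level.sT

/-- The substitution rule `subst(t) = (Net(t) ← CP(t) → SN^t)`. -/
noncomputable def subst (RN : ReconfNet A N) (t : RN.sT) : PTNet.Rule.{u} AP AT where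
  L := N.netOf t.1
  K := N.cpOf t.1
  R := RN.level.subNet t
  l := N.cpToNet t.1
  r := RN.level.emb t
  l_strict := N.cpToNet_isStrict t.1
  r_strict := RN.level.emb_strict t

/-- The substitution of `t`: the rule `subst(t)` at its occurrence `Net(t) ↪ N`. -/
noncomputable def substitution (RN : ReconfNet A N) (t : RN.sT) : PTNet.Match N :=
  ⟨RN.subst t, N.netIncl t.1⟩

/-- The set `S^N` of substitutions. -/
def substitutions (RN : ReconfNet A N) : Set (PTNet.Match N) :=
  Set.range RN.substitution

end ReconfNet

/-! A substitution rule deletes one transition and no place, and its interface `CP(t)` has no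
transitions. Hence applying one substitution leaves intact everything that another one needs, and
all of them can be described at once. Let `D` be `N` without all substitution transitions. The
result is the colimit of `D` and the right-hand sides, each glued to `D` along its interface.
`Flattening` records this description. It mentions no order, and it determines the net up to
isomorphism: `D` is determined by the deleted set, the maps from the interfaces to `D` are
determined because `D → N` is monic, and colimits are unique (`Flattening.nonempty_iso`).

It remains to see that every procedure produces a flattening and that every procedure can be carried
out. For sequences, `Flattening.cons` composes a step with a flattening along the residuals; for the
parallel rule, the universal property of the coproduct splits one pushout into the individual
gluings (`ParallelStep.nonempty_flattening`).

Both arguments need the context net of a step to be known, although it is only given by a pushout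
property. Pushouts along strict morphisms are therefore computed explicitly (`glue`), and every such
pushout is identified elementwise (`isGluing_of_isPushout`). The same computation yields the
existence of steps. -/

namespace PTNet

variable {AP : Type v} {AT : Type w} [PartialOrder AP] [PartialOrder AT]

/-! ### Net morphisms, strictness and isomorphisms -/

@[simp] theorem comp_fP {N M K : PTNet.{u} AP AT} (f : N ⟶ M) (g : M ⟶ K) (p : N.P) :
    Hom.fP (f ≫ g) p = Hom.fP g (Hom.fP f p) := rfl

@[simp] theorem comp_fT {N M K : PTNet.{u} AP AT} (f : N ⟶ M) (g : M ⟶ K) (t : N.T) :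
    Hom.fT (f ≫ g) t = Hom.fT g (Hom.fT f t) := rfl

theorem hom_ext {N M : PTNet.{u} AP AT} {f g : N ⟶ M}
    (hP : ∀ p, Hom.fP f p = Hom.fP g p) (hT : ∀ t, Hom.fT f t = Hom.fT g t) : f = g :=
  Hom.ext (funext hP) (funext hT)

theorem congr_fP {N M : PTNet.{u} AP AT} {f g : N ⟶ M} (h : f = g) (p : N.P) :
    Hom.fP f p = Hom.fP g p := by rw [h]

theorem congr_fT {N M : PTNet.{u} AP AT} {f g : N ⟶ M} (h : f = g) (t : N.T) :
    Hom.fT f t = Hom.fT g t := by rw [h]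

theorem IsStrict.comp {N M K : PTNet.{u} AP AT} {f : N ⟶ M} {g : M ⟶ K}
    (hf : IsStrict f) (hg : IsStrict g) : IsStrict (f ≫ g) where
  injP := hg.injP.comp hf.injP
  injT := hg.injT.comp hf.injT
  pname_eq p := (hg.pname_eq _).trans (hf.pname_eq p)
  tname_eq t := (hg.tname_eq _).trans (hf.tname_eq t)
  marking_eq p := (hf.marking_eq p).trans (hg.marking_eq _)

theorem fP_hom_inv {N M : PTNet.{u} AP AT} (e : N ≅ M) (p : N.P) :
    Hom.fP e.inv (Hom.fP e.hom p) = p := congr_fP e.hom_inv_id p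

theorem fT_hom_inv {N M : PTNet.{u} AP AT} (e : N ≅ M) (t : N.T) :
    Hom.fT e.inv (Hom.fT e.hom t) = t := congr_fT e.hom_inv_id t

/-- The inequalities for `e.hom` and for `e.inv` are opposite, so names and markings agree by
antisymmetry. -/
theorem isStrict_iso_hom {N M : PTNet.{u} AP AT} (e : N ≅ M) : IsStrict e.hom where
  injP := Function.LeftInverse.injective (fP_hom_inv e)
  injT := Function.LeftInverse.injective (fT_hom_inv e)
  pname_eq p := le_antisymm (e.hom.pname_le p) (by
    have := e.inv.pname_le (Hom.fP e.hom p)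
    rwa [fP_hom_inv] at this)
  tname_eq t := le_antisymm (e.hom.tname_le t) (by
    have := e.inv.tname_le (Hom.fT e.hom t)
    rwa [fT_hom_inv] at this)
  marking_eq p := le_antisymm (e.hom.marking_le p) (by
    have := e.inv.marking_le (Hom.fP e.hom p)
    rwa [fP_hom_inv] at this)

/-! ### Pushouts along strict morphisms -/

/-- A map out of a set that is covered by an injective image of `D` and a disjoint injective image
of the complement of `K` in `R`. -/
theorem exists_glued_map {K R D M X : Type*} {r : K → R} {k : K → D} {n : R → M} {m : D → M}
    (w : ∀ x, n (r x) = m (k x)) (hm : Function.Injective m) (hn : Set.InjOn n (Set.range r)ᶜ)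
    (disj : ∀ x ∉ Set.range r, n x ∉ Set.range m)
    (cover : ∀ y, y ∈ Set.range m ∨ ∃ x ∉ Set.range r, n x = y)
    (h : D → X) (c : R → X) (hc : ∀ x, c (r x) = h (k x)) :
    ∃ u : M → X, (∀ x, u (m x) = h x) ∧ ∀ x, u (n x) = c x := by
  classical
  -- Both requirements on the value at `y` are stated together, so that a pointwise choice already
  -- gives both equations.
  have key : ∀ y, ∃ z, (∀ x, m x = y → z = h x) ∧ ∀ x, n x = y → z = c x := by
    intro y
    rcases cover y with ⟨x, rfl⟩ | ⟨x, hx, rfl⟩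
    · refine ⟨h x, fun x' hx' => by rw [hm hx'], fun x' hx' => ?_⟩
      by_cases hr : x' ∈ Set.range r
      · obtain ⟨a, rfl⟩ := hr
        rw [hc, hm (hx'.symm.trans (w a))]
      · exact absurd ⟨x, hx'.symm⟩ (disj x' hr)
    · refine ⟨c x, fun x' hx' => absurd ⟨x', hx'⟩ (disj x hx), fun x' hx' => ?_⟩
      by_cases hr : x' ∈ Set.range r
      · obtain ⟨a, rfl⟩ := hr
        exact absurd ⟨k a, by rw [← hx', w]⟩ (disj x hx)
      · rw [hn hr hx hx']
  choose u hu₁ hu₂ using key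
  exact ⟨u, fun x => hu₁ _ x rfl, fun x => hu₂ _ x rfl⟩

/-- An elementwise description of the pushout squares along a strict morphism `r`: the net `M`
is the disjoint union of `D` and of the part of `R` outside `K`. -/
structure IsGluing {K R D M : PTNet.{u} AP AT} (r : K ⟶ R) (k : K ⟶ D) (n : R ⟶ M)
    (m : D ⟶ M) : Prop where
  w : r ≫ n = k ≫ m
  strict : IsStrict m
  injOnP : Set.InjOn (Hom.fP n) (Set.range (Hom.fP r))ᶜ
  injOnT : Set.InjOn (Hom.fT n) (Set.range (Hom.fT r))ᶜ
  disjP : ∀ x ∉ Set.range (Hom.fP r), Hom.fP n x ∉ Set.range (Hom.fP m)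
  disjT : ∀ x ∉ Set.range (Hom.fT r), Hom.fT n x ∉ Set.range (Hom.fT m)
  coverP : ∀ y, y ∈ Set.range (Hom.fP m) ∨ ∃ x ∉ Set.range (Hom.fP r), Hom.fP n x = y
  coverT : ∀ y, y ∈ Set.range (Hom.fT m) ∨ ∃ x ∉ Set.range (Hom.fT r), Hom.fT n x = y
  pname_eq : ∀ x ∉ Set.range (Hom.fP r), M.pname (Hom.fP n x) = R.pname x
  tname_eq : ∀ x ∉ Set.range (Hom.fT r), M.tname (Hom.fT n x) = R.tname x
  marking_eq : ∀ x ∉ Set.range (Hom.fP r), R.marking x = M.marking (Hom.fP n x)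

namespace IsGluing

variable {K R D M X : PTNet.{u} AP AT} {r : K ⟶ R} {k : K ⟶ D} {n : R ⟶ M} {m : D ⟶ M}

/-- Every place and transition of `M` comes from `D` or from `R` outside `K`, and there it carries
exactly its old name and marking. The conditions on the glued map are thus inherited from `h` and
`c`. -/
theorem exists_desc (G : IsGluing r k n m) (c : R ⟶ X) (h : D ⟶ X) (hc : r ≫ c = k ≫ h) :
    ∃ f : M ⟶ X, n ≫ f = c ∧ m ≫ f = h := by
  obtain ⟨uP, hPm, hPn⟩ := exists_glued_map (r := Hom.fP r) (k := Hom.fP k)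
    (congr_fP G.w) G.strict.injP G.injOnP G.disjP G.coverP (Hom.fP h) (Hom.fP c) (congr_fP hc)
  obtain ⟨uT, hTm, hTn⟩ := exists_glued_map (r := Hom.fT r) (k := Hom.fT k)
    (congr_fT G.w) G.strict.injT G.injOnT G.disjT G.coverT (Hom.fT h) (Hom.fT c) (congr_fT hc)
  have ePm : uP ∘ Hom.fP m = Hom.fP h := funext hPm
  have ePn : uP ∘ Hom.fP n = Hom.fP c := funext hPn
  refine ⟨(⟨uP, uT, ?_, ?_, ?_, ?_, ?_⟩ : Hom M X), hom_ext hPn hTn, hom_ext hPm hTm⟩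
  · intro t
    rcases G.coverT t with ⟨x, rfl⟩ | ⟨x, -, rfl⟩
    · rw [hTm, m.pre_comm, ← Finsupp.mapDomain_comp, ePm, h.pre_comm]
    · rw [hTn, n.pre_comm, ← Finsupp.mapDomain_comp, ePn, c.pre_comm]
  · intro t
    rcases G.coverT t with ⟨x, rfl⟩ | ⟨x, -, rfl⟩
    · rw [hTm, m.post_comm, ← Finsupp.mapDomain_comp, ePm, h.post_comm]
    · rw [hTn, n.post_comm, ← Finsupp.mapDomain_comp, ePn, c.post_comm]
  · intro p
    rcases G.coverP p with ⟨x, rfl⟩ | ⟨x, hx, rfl⟩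
    · rw [hPm, G.strict.pname_eq]
      exact h.pname_le x
    · rw [hPn, G.pname_eq x hx]
      exact c.pname_le x
  · intro t
    rcases G.coverT t with ⟨x, rfl⟩ | ⟨x, hx, rfl⟩
    · rw [hTm, G.strict.tname_eq]
      exact h.tname_le x
    · rw [hTn, G.tname_eq x hx]
      exact c.tname_le x
  · intro p
    rcases G.coverP p with ⟨x, rfl⟩ | ⟨x, hx, rfl⟩
    · rw [hPm, ← G.strict.marking_eq]
      exact h.marking_le x
    · rw [hPn, ← G.marking_eq x hx]
      exact c.marking_le x

theorem hom_ext (G : IsGluing r k n m) {f g : M ⟶ X} (hn : n ≫ f = n ≫ g)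
    (hm : m ≫ f = m ≫ g) : f = g := by
  refine PTNet.hom_ext (fun p => ?_) fun t => ?_
  · rcases G.coverP p with ⟨x, rfl⟩ | ⟨x, -, rfl⟩
    exacts [congr_fP hm x, congr_fP hn x]
  · rcases G.coverT t with ⟨x, rfl⟩ | ⟨x, -, rfl⟩
    exacts [congr_fT hm x, congr_fT hn x]

theorem isPushout (G : IsGluing r k n m) : IsPushout r k n m := by
  have H : ∀ s : Limits.PushoutCocone r k, ∃ f : M ⟶ s.pt, n ≫ f = s.inl ∧ m ≫ f = s.inr :=
    fun s => G.exists_desc s.inl s.inr s.condition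
  choose desc h₁ h₂ using H
  exact ⟨⟨G.w⟩, ⟨Limits.PushoutCocone.IsColimit.mk G.w desc h₁ h₂ fun s f hn hm =>
    G.hom_ext (hn.trans (h₁ s).symm) (hm.trans (h₂ s).symm)⟩⟩

theorem comp_iso (G : IsGluing r k n m) (e : M ≅ X) :
    IsGluing r k (n ≫ e.hom) (m ≫ e.hom) where
  w := by rw [← Category.assoc, G.w, Category.assoc]
  strict := G.strict.comp (isStrict_iso_hom e)
  injOnP := (isStrict_iso_hom e).injP.comp_injOn G.injOnP
  injOnT := (isStrict_iso_hom e).injT.comp_injOn G.injOnT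
  disjP := by
    rintro x hx ⟨y, hy⟩
    exact G.disjP x hx ⟨y, (isStrict_iso_hom e).injP hy⟩
  disjT := by
    rintro x hx ⟨y, hy⟩
    exact G.disjT x hx ⟨y, (isStrict_iso_hom e).injT hy⟩
  coverP y := by
    rcases G.coverP (Hom.fP e.inv y) with ⟨x, hx⟩ | ⟨x, hx, h⟩
    · exact Or.inl ⟨x, by rw [comp_fP, hx]; exact fP_hom_inv e.symm y⟩
    · exact Or.inr ⟨x, hx, by rw [comp_fP, h]; exact fP_hom_inv e.symm y⟩
  coverT y := by
    rcases G.coverT (Hom.fT e.inv y) with ⟨x, hx⟩ | ⟨x, hx, h⟩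
    · exact Or.inl ⟨x, by rw [comp_fT, hx]; exact fT_hom_inv e.symm y⟩
    · exact Or.inr ⟨x, hx, by rw [comp_fT, h]; exact fT_hom_inv e.symm y⟩
  pname_eq x hx := ((isStrict_iso_hom e).pname_eq _).trans (G.pname_eq x hx)
  tname_eq x hx := ((isStrict_iso_hom e).tname_eq _).trans (G.tname_eq x hx)
  marking_eq x hx := (G.marking_eq x hx).trans ((isStrict_iso_hom e).marking_eq _)

end IsGluing

section Glue

open Classical in
/-- The map from `R` to the disjoint union of `D` and the complement of `K` in `R`. -/
noncomputable def toGlue {K R D : Type*} (r : K → R) (k : K → D) (x : R) :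
    D ⊕ {x : R // x ∉ Set.range r} :=
  if h : x ∈ Set.range r then Sum.inl (k h.choose) else Sum.inr ⟨x, h⟩

theorem toGlue_apply {K R D : Type*} {r : K → R} (hr : Function.Injective r) (k : K → D) (x : K) :
    toGlue r k (r x) = Sum.inl (k x) := by
  have h : r x ∈ Set.range r := ⟨x, rfl⟩
  rw [toGlue, dif_pos h, hr h.choose_spec]

theorem toGlue_of_notMem {K R D : Type*} {r : K → R} (k : K → D) {x : R}
    (hx : x ∉ Set.range r) : toGlue r k x = Sum.inr ⟨x, hx⟩ := dif_neg hx

/-- This makes `glueInr` compatible with pre- and post-domains on the transitions of `R` that come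
from `K`. -/
theorem mapDomain_toGlue {K R D : Type*} {r : K → R} (hr : Function.Injective r) (k : K → D)
    (a : K →₀ ℕ) :
    (a.mapDomain k).mapDomain Sum.inl = (a.mapDomain r).mapDomain (toGlue r k) := by
  rw [← Finsupp.mapDomain_comp, ← Finsupp.mapDomain_comp]
  congr 1
  exact funext fun x => (toGlue_apply hr k x).symm

variable {K R D : PTNet.{u} AP AT}

/-- The pushout of `r` and `k` for strict `r`. -/
noncomputable def glue (r : K ⟶ R) (k : K ⟶ D) : PTNet.{u} AP AT where
  P := D.P ⊕ {x : R.P // x ∉ Set.range (Hom.fP r)}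
  T := D.T ⊕ {x : R.T // x ∉ Set.range (Hom.fT r)}
  pre := Sum.elim (fun t => (D.pre t).mapDomain Sum.inl)
    fun t => (R.pre t).mapDomain (toGlue (Hom.fP r) (Hom.fP k))
  post := Sum.elim (fun t => (D.post t).mapDomain Sum.inl)
    fun t => (R.post t).mapDomain (toGlue (Hom.fP r) (Hom.fP k))
  pname := Sum.elim D.pname fun p => R.pname p
  tname := Sum.elim D.tname fun t => R.tname t
  marking := Finsupp.sumElim D.marking (R.marking.subtypeDomain (· ∉ Set.range (Hom.fP r)))

/-- The inclusion of `D` into the pushout. -/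
noncomputable def glueInl (r : K ⟶ R) (k : K ⟶ D) : D ⟶ glue r k :=
  ({ fP := Sum.inl
     fT := Sum.inl
     pre_comm := fun _ => rfl
     post_comm := fun _ => rfl
     pname_le := fun _ => le_rfl
     tname_le := fun _ => le_rfl
     marking_le := fun _ => le_rfl } : Hom D (glue r k))

/-- The coprojection of `R` into the pushout. -/
noncomputable def glueInr {r : K ⟶ R} (hr : IsStrict r) (k : K ⟶ D) : R ⟶ glue r k :=
  ({ fP := toGlue (Hom.fP r) (Hom.fP k)
     fT := toGlue (Hom.fT r) (Hom.fT k)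
     pre_comm := fun t => by
       by_cases ht : t ∈ Set.range (Hom.fT r)
       · obtain ⟨t, rfl⟩ := ht
         rw [toGlue_apply hr.injT]
         change (D.pre (Hom.fT k t)).mapDomain Sum.inl = _
         rw [k.pre_comm, r.pre_comm]
         exact mapDomain_toGlue hr.injP _ _
       · rw [toGlue_of_notMem _ ht]
         rfl
     post_comm := fun t => by
       by_cases ht : t ∈ Set.range (Hom.fT r)
       · obtain ⟨t, rfl⟩ := ht
         rw [toGlue_apply hr.injT]
         change (D.post (Hom.fT k t)).mapDomain Sum.inl = _
         rw [k.post_comm, r.post_comm]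
         exact mapDomain_toGlue hr.injP _ _
       · rw [toGlue_of_notMem _ ht]
         rfl
     pname_le := fun p => by
       by_cases hp : p ∈ Set.range (Hom.fP r)
       · obtain ⟨p, rfl⟩ := hp
         rw [toGlue_apply hr.injP, hr.pname_eq]
         exact k.pname_le p
       · rw [toGlue_of_notMem _ hp]
         exact le_rfl
     tname_le := fun t => by
       by_cases ht : t ∈ Set.range (Hom.fT r)
       · obtain ⟨t, rfl⟩ := ht
         rw [toGlue_apply hr.injT, hr.tname_eq]
         exact k.tname_le t
       · rw [toGlue_of_notMem _ ht]
         exact le_rfl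
     marking_le := fun p => by
       by_cases hp : p ∈ Set.range (Hom.fP r)
       · obtain ⟨p, rfl⟩ := hp
         rw [toGlue_apply hr.injP, ← hr.marking_eq]
         exact k.marking_le p
       · rw [toGlue_of_notMem _ hp]
         exact le_rfl } : Hom R (glue r k))

theorem glue_isGluing {r : K ⟶ R} (hr : IsStrict r) (k : K ⟶ D) :
    IsGluing r k (glueInr hr k) (glueInl r k) where
  w := hom_ext (fun p => toGlue_apply hr.injP _ p) fun t => toGlue_apply hr.injT _ t
  strict := ⟨Sum.inl_injective, Sum.inl_injective, fun _ => rfl, fun _ => rfl, fun _ => rfl⟩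
  injOnP x hx y hy h := by
    have h : toGlue (Hom.fP r) (Hom.fP k) x = toGlue (Hom.fP r) (Hom.fP k) y := h
    rw [toGlue_of_notMem _ hx, toGlue_of_notMem _ hy] at h
    exact congrArg Subtype.val (Sum.inr_injective h)
  injOnT x hx y hy h := by
    have h : toGlue (Hom.fT r) (Hom.fT k) x = toGlue (Hom.fT r) (Hom.fT k) y := h
    rw [toGlue_of_notMem _ hx, toGlue_of_notMem _ hy] at h
    exact congrArg Subtype.val (Sum.inr_injective h)
  disjP x hx := by
    rintro ⟨y, hy⟩
    exact Sum.inl_ne_inr (hy.trans (toGlue_of_notMem _ hx))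
  disjT x hx := by
    rintro ⟨y, hy⟩
    exact Sum.inl_ne_inr (hy.trans (toGlue_of_notMem _ hx))
  coverP := by
    rintro (y | y)
    exacts [Or.inl ⟨y, rfl⟩, Or.inr ⟨y, y.2, toGlue_of_notMem _ y.2⟩]
  coverT := by
    rintro (y | y)
    exacts [Or.inl ⟨y, rfl⟩, Or.inr ⟨y, y.2, toGlue_of_notMem _ y.2⟩]
  pname_eq x hx := congrArg (glue r k).pname (toGlue_of_notMem _ hx)
  tname_eq x hx := congrArg (glue r k).tname (toGlue_of_notMem _ hx)
  marking_eq x hx := (congrArg (glue r k).marking (toGlue_of_notMem _ hx)).symm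

/-- Any pushout is isomorphic to `glue r k`, compatibly with the coprojections, and the elementwise
description is transported along isomorphisms. -/
theorem isGluing_of_isPushout {M : PTNet.{u} AP AT} {r : K ⟶ R} (hr : IsStrict r) {k : K ⟶ D}
    {n : R ⟶ M} {m : D ⟶ M} (h : IsPushout r k n m) : IsGluing r k n m := by
  have G := glue_isGluing hr k
  have := G.comp_iso (G.isPushout.isoIsPushout _ _ h)
  rwa [IsPushout.inl_isoIsPushout_hom, IsPushout.inr_isoIsPushout_hom] at this

end Glue

/-! ### Strict subnets and removal of transitions -/

theorem IsStrict.of_comp {N M K : PTNet.{u} AP AT} {f : N ⟶ M} {g : M ⟶ K}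
    (h : IsStrict (f ≫ g)) (hg : IsStrict g) : IsStrict f where
  injP := Function.Injective.of_comp (f := Hom.fP g) h.injP
  injT := Function.Injective.of_comp (f := Hom.fT g) h.injT
  pname_eq p := (hg.pname_eq _).symm.trans (h.pname_eq p)
  tname_eq t := (hg.tname_eq _).symm.trans (h.tname_eq t)
  marking_eq p := (h.marking_eq p).trans (hg.marking_eq _).symm

theorem IsStrict.cancel {N M K : PTNet.{u} AP AT} {g : M ⟶ K} (hg : IsStrict g) {f f' : N ⟶ M}
    (h : f ≫ g = f' ≫ g) : f = f' :=
  hom_ext (fun p => hg.injP (congr_fP h p)) fun t => hg.injT (congr_fT h t)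

/-- `d` is, up to isomorphism, the inclusion of the net obtained from `N` by removing the
transitions in `S`. -/
structure IsComplement {D N : PTNet.{u} AP AT} (d : D ⟶ N) (S : Set N.T) : Prop where
  strict : IsStrict d
  surjP : Function.Surjective (Hom.fP d)
  mem_range : ∀ t, t ∈ Set.range (Hom.fT d) ↔ t ∉ S

/-- Strictness of `d` lets every morphism condition be checked after composing with `d`. This is the
source of residual occurrences and of comparison maps between complements. -/
theorem IsComplement.exists_lift {D N X : PTNet.{u} AP AT} {d : D ⟶ N} {S : Set N.T}
    (C : IsComplement d S) (f : X ⟶ N) (hf : ∀ t, Hom.fT f t ∉ S) : ∃ g : X ⟶ D, g ≫ d = f := by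
  choose gP hP using fun p => C.surjP (Hom.fP f p)
  choose gT hT using fun t => (C.mem_range _).2 (hf t)
  have e : Hom.fP d ∘ gP = Hom.fP f := funext hP
  refine ⟨(⟨gP, gT, fun t => ?_, fun t => ?_, fun p => ?_, fun t => ?_, fun p => ?_⟩ : Hom X D),
    hom_ext hP hT⟩
  · apply Finsupp.mapDomain_injective C.strict.injP
    rw [← d.pre_comm, ← Finsupp.mapDomain_comp, e, hT, f.pre_comm]
  · apply Finsupp.mapDomain_injective C.strict.injP
    rw [← d.post_comm, ← Finsupp.mapDomain_comp, e, hT, f.post_comm]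
  · rw [← C.strict.pname_eq, hP]
    exact f.pname_le p
  · rw [← C.strict.tname_eq, hT]
    exact f.tname_le t
  · rw [C.strict.marking_eq, hP]
    exact f.marking_le p

theorem isComplement_id (N : PTNet.{u} AP AT) : IsComplement (𝟙 N) ∅ where
  strict := isStrict_iso_hom (Iso.refl N)
  surjP := Function.surjective_id
  mem_range t := ⟨fun _ h => h, fun _ => ⟨t, rfl⟩⟩

/-- The net `N` without the transitions in `S`. -/
def removeTransitions (N : PTNet.{u} AP AT) (S : Set N.T) : PTNet.{u} AP AT where
  P := N.P
  T := {t : N.T // t ∉ S}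
  pre t := N.pre t
  post t := N.post t
  pname := N.pname
  tname t := N.tname t
  marking := N.marking

/-- The inclusion of `N` without the transitions in `S` into `N`. -/
def removeTransitionsIncl (N : PTNet.{u} AP AT) (S : Set N.T) : N.removeTransitions S ⟶ N :=
  ({ fP := id
     fT := Subtype.val
     pre_comm := fun t => (Finsupp.mapDomain_id (v := N.pre t.1)).symm
     post_comm := fun t => (Finsupp.mapDomain_id (v := N.post t.1)).symm
     pname_le := fun _ => le_rfl
     tname_le := fun _ => le_rfl
     marking_le := fun _ => le_rfl } : Hom (N.removeTransitions S) N)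

theorem removeTransitionsIncl_isComplement (N : PTNet.{u} AP AT) (S : Set N.T) :
    IsComplement (N.removeTransitionsIncl S) S where
  strict := ⟨Function.injective_id, Subtype.val_injective, fun _ => rfl, fun _ => rfl,
    fun _ => rfl⟩
  surjP := Function.surjective_id
  mem_range t := ⟨by rintro ⟨x, rfl⟩; exact x.2, fun h => ⟨⟨t, h⟩, rfl⟩⟩

/-! ### Steps of rules that delete only transitions -/

/-- A rule that deletes all the transitions of its left-hand side and no places. -/
structure Rule.IsTransitional (ρ : Rule.{u} AP AT) : Prop where
  surjP : Function.Surjective (Hom.fP ρ.l)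
  isEmpty : IsEmpty ρ.K.T

section Step

variable {ρ : Rule.{u} AP AT} {N M : PTNet.{u} AP AT} {o : ρ.L ⟶ N}

theorem Rule.IsTransitional.notMem_range (hρ : ρ.IsTransitional) {X : PTNet.{u} AP AT}
    (f : ρ.K ⟶ X) (t : X.T) : t ∉ Set.range (Hom.fT f) := by
  rintro ⟨x, -⟩
  exact hρ.isEmpty.elim x

/-- In the first pushout, the part of `L` outside `K` consists of all transitions and no places; so
`D` has all the places of `N` and exactly the transitions missed by `o`. -/
theorem Step.isComplement (hρ : ρ.IsTransitional) (d : Step ρ o M) :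
    IsComplement d.toN (Set.range (Hom.fT o)) := by
  have G := isGluing_of_isPushout ρ.l_strict d.po₁
  refine ⟨G.strict, fun p => ?_, fun t => ⟨?_, fun h => ?_⟩⟩
  · exact (G.coverP p).resolve_right fun ⟨x, hx, _⟩ => hx (hρ.surjP x)
  · rintro h ⟨x, rfl⟩
    exact G.disjT x (hρ.notMem_range _ _) h
  · exact (G.coverT t).resolve_right fun ⟨x, _, hx⟩ => h ⟨x, hx⟩

theorem Step.occ_injective (hρ : ρ.IsTransitional) (d : Step ρ o M) :
    Function.Injective (Hom.fT o) := fun _ _ h =>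
  (isGluing_of_isPushout ρ.l_strict d.po₁).injOnT (hρ.notMem_range _ _) (hρ.notMem_range _ _) h

theorem Step.toM_isStrict (d : Step ρ o M) : IsStrict d.toM :=
  (isGluing_of_isPushout ρ.r_strict d.po₂).strict

/-- A transitional rule is applicable at each occurrence that is injective on transitions and
preserves their names. -/
theorem exists_step (hρ : ρ.IsTransitional) (hinj : Function.Injective (Hom.fT o))
    (hname : ∀ t, N.tname (Hom.fT o t) = ρ.L.tname t) :
    ∃ M : PTNet.{u} AP AT, Nonempty (Step ρ o M) := by
  have C := N.removeTransitionsIncl_isComplement (Set.range (Hom.fT o))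
  obtain ⟨k, hk⟩ := C.exists_lift (ρ.l ≫ o) fun t => hρ.isEmpty.elim t
  have hsurj : ∀ x, x ∈ Set.range (Hom.fP ρ.l) := hρ.surjP
  -- The place conditions outside `K` are vacuous. Name preservation is essential: a transition with
  -- a strictly smaller name in `N` would prevent `N` from being the pushout.
  have G : IsGluing ρ.l k o (N.removeTransitionsIncl (Set.range (Hom.fT o))) :=
    { w := hk.symm
      strict := C.strict
      injOnP := fun x hx => absurd (hsurj x) hx
      injOnT := hinj.injOn
      disjP := fun x hx => absurd (hsurj x) hx
      disjT := fun x _ h => (C.mem_range _).1 h ⟨x, rfl⟩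
      coverP := fun y => Or.inl (C.surjP y)
      coverT := fun y => by
        by_cases hy : y ∈ Set.range (Hom.fT o)
        · obtain ⟨x, rfl⟩ := hy
          exact Or.inr ⟨x, hρ.notMem_range _ _, rfl⟩
        · exact Or.inl ((C.mem_range y).2 hy)
      pname_eq := fun x hx => absurd (hsurj x) hx
      tname_eq := fun x _ => hname x
      marking_eq := fun x hx => absurd (hsurj x) hx }
  exact ⟨_, ⟨⟨_, k, _, _, _, G.isPushout, (glue_isGluing ρ.r_strict k).isPushout⟩⟩⟩

end Step

/-! ### Flattenings: uniqueness and composition with a step -/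

/-- `F` is obtained from `N` by removing the transitions in the images of all the occurrences and
gluing in the right-hand sides of all the rules, as a colimit. -/
structure Flattening {ι : Type*} {N : PTNet.{u} AP AT} (s : ι → Match N)
    (F : PTNet.{u} AP AT) where
  D : PTNet.{u} AP AT
  d : D ⟶ N
  k : ∀ i, (s i).rule.K ⟶ D
  a : D ⟶ F
  b : ∀ i, (s i).rule.R ⟶ F
  disj : ∀ i j, i ≠ j → ∀ x y, Hom.fT (s i).occ x ≠ Hom.fT (s j).occ y
  compl : IsComplement d (⋃ i, Set.range (Hom.fT (s i).occ))
  k_d : ∀ i, k i ≫ d = (s i).rule.l ≫ (s i).occ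
  w : ∀ i, (s i).rule.r ≫ b i = k i ≫ a
  exists_desc : ∀ {X : PTNet.{u} AP AT} (h : D ⟶ X) (c : ∀ i, (s i).rule.R ⟶ X),
    (∀ i, (s i).rule.r ≫ c i = k i ≫ h) → ∃ f : F ⟶ X, a ≫ f = h ∧ ∀ i, b i ≫ f = c i
  hom_ext : ∀ {X : PTNet.{u} AP AT} {f g : F ⟶ X}, a ≫ f = a ≫ g →
    (∀ i, b i ≫ f = b i ≫ g) → f = g

namespace Flattening

variable {ι : Type*} {N M F F' : PTNet.{u} AP AT} {s : ι → Match N}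

/-- The interface maps are compatible with `q` automatically, since they agree after composition
with the monic `B.d`. -/
theorem exists_hom (A : Flattening s F) (B : Flattening s F') (q : A.D ⟶ B.D)
    (hq : q ≫ B.d = A.d) : ∃ f : F ⟶ F', A.a ≫ f = q ≫ B.a ∧ ∀ i, A.b i ≫ f = B.b i := by
  refine A.exists_desc (q ≫ B.a) B.b fun i => ?_
  rw [B.w, ← Category.assoc]
  congr 1
  exact B.compl.strict.cancel (by rw [Category.assoc, hq, A.k_d, B.k_d])

theorem nonempty_iso (A : Flattening s F) (B : Flattening s F') : Nonempty (F ≅ F') := by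
  obtain ⟨q, hq⟩ := B.compl.exists_lift A.d fun t => (A.compl.mem_range _).1 ⟨t, rfl⟩
  obtain ⟨q', hq'⟩ := A.compl.exists_lift B.d fun t => (B.compl.mem_range _).1 ⟨t, rfl⟩
  have hqq : q ≫ q' = 𝟙 _ := A.compl.strict.cancel (by simp [hq, hq'])
  have hqq' : q' ≫ q = 𝟙 _ := B.compl.strict.cancel (by simp [hq, hq'])
  obtain ⟨f, hf, hfb⟩ := A.exists_hom B q hq
  obtain ⟨f', hf', hfb'⟩ := B.exists_hom A q' hq'
  refine ⟨⟨f, f', A.hom_ext ?_ fun i => ?_, B.hom_ext ?_ fun i => ?_⟩⟩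
  · rw [← Category.assoc, hf, Category.assoc, hf', ← Category.assoc, hqq, Category.id_comp,
      Category.comp_id]
  · rw [← Category.assoc, hfb, hfb', Category.comp_id]
  · rw [← Category.assoc, hf', Category.assoc, hf, ← Category.assoc, hqq', Category.id_comp,
      Category.comp_id]
  · rw [← Category.assoc, hfb', hfb, Category.comp_id]

/-- A flattening along a family can be reindexed. -/
theorem reindex {κ : Type*} (e : κ ≃ ι) (A : Flattening (fun j => s (e j)) F) :
    Nonempty (Flattening s F) := by
  -- Rewriting `s` as a family pulled back along `e.symm` makes the types of `k` and `b` match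
  -- without casts.
  obtain ⟨t, rfl⟩ : ∃ t : κ → Match N, s = fun i => t (e.symm i) :=
    ⟨fun j => s (e j), by simp⟩
  have hte : (fun j => t (e.symm (e j))) = t := by simp
  rw [hte] at A
  exact ⟨{
    D := A.D
    d := A.d
    k := fun i => A.k (e.symm i)
    a := A.a
    b := fun i => A.b (e.symm i)
    disj := fun i j h => A.disj _ _ (e.symm.injective.ne h)
    compl := by
      convert A.compl using 1
      exact e.symm.surjective.iUnion_comp fun j => Set.range (Hom.fT (t j).occ)
    k_d := fun i => A.k_d _
    w := fun i => A.w _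
    exists_desc := fun h c hc => by
      obtain ⟨c, rfl⟩ : ∃ c' : ∀ j, (t j).rule.R ⟶ _, c = fun i => c' (e.symm i) := by
        refine ⟨(Equiv.piCongrLeft' (fun j => (t j).rule.R ⟶ _) e).symm c, ?_⟩
        exact ((Equiv.piCongrLeft' (fun j => (t j).rule.R ⟶ _) e).apply_symm_apply c).symm
      obtain ⟨f, hf, hfc⟩ := A.exists_desc h c fun j => by
        obtain ⟨i, rfl⟩ := e.symm.surjective j
        exact hc i
      exact ⟨f, hf, fun i => hfc _⟩
    hom_ext := fun h hb => A.hom_ext h fun j => by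
      obtain ⟨i, rfl⟩ := e.symm.surjective j
      exact hb i }⟩

/-- An isomorphism is a flattening along the empty family. -/
def ofIsEmpty [IsEmpty ι] (s : ι → Match N) (e : N ≅ F) : Flattening s F where
  D := N
  d := 𝟙 N
  k i := isEmptyElim i
  a := e.hom
  b i := isEmptyElim i
  disj i := isEmptyElim i
  compl := by simpa using isComplement_id N
  k_d i := isEmptyElim i
  w i := isEmptyElim i
  exists_desc h _ _ := ⟨e.inv ≫ h, by simp, fun i => isEmptyElim i⟩
  hom_ext h _ := (cancel_epi e.hom).1 h

/-- `M` is the disjoint union of `D` and the part of `R` outside `K`. Deleting transitions that lie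
in `D` leaves the second part unchanged, so the right-hand pushout of the step restricts to the
complements. -/
theorem isGluing_complement {ρ : Rule.{u} AP AT} {o : ρ.L ⟶ N}
    (st : Step ρ o M) {S : Set st.D.T} {E E' : PTNet.{u} AP AT} {j : E ⟶ st.D} {j' : E' ⟶ M}
    (hj : IsComplement j S) (hj' : IsComplement j' (Hom.fT st.toM '' S)) {k : ρ.K ⟶ E}
    {n : ρ.R ⟶ E'} {q : E ⟶ E'} (hk : k ≫ j = st.k) (hn : n ≫ j' = st.n)
    (hq : q ≫ j' = j ≫ st.toM) : IsGluing ρ.r k n q := by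
  have G := isGluing_of_isPushout ρ.r_strict st.po₂
  have hnP : ∀ x, Hom.fP j' (Hom.fP n x) = Hom.fP st.n x := congr_fP hn
  have hnT : ∀ x, Hom.fT j' (Hom.fT n x) = Hom.fT st.n x := congr_fT hn
  have hqP : ∀ x, Hom.fP j' (Hom.fP q x) = Hom.fP st.toM (Hom.fP j x) := congr_fP hq
  have hqT : ∀ x, Hom.fT j' (Hom.fT q x) = Hom.fT st.toM (Hom.fT j x) := congr_fT hq
  refine
    { w := hj'.strict.cancel ?_
      strict := IsStrict.of_comp (hq ▸ hj.strict.comp G.strict) hj'.strict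
      injOnP := fun x hx y hy h => G.injOnP hx hy ?_
      injOnT := fun x hx y hy h => G.injOnT hx hy ?_
      disjP := ?_
      disjT := ?_
      coverP := fun y => ?_
      coverT := fun y => ?_
      pname_eq := fun x hx => ?_
      tname_eq := fun x hx => ?_
      marking_eq := fun x hx => ?_ }
  · rw [Category.assoc, Category.assoc, hn, hq, ← Category.assoc, hk, G.w]
  · rw [← hnP, ← hnP, h]
  · rw [← hnT, ← hnT, h]
  · rintro x hx ⟨y, hy⟩
    exact G.disjP x hx ⟨Hom.fP j y, by rw [← hqP, hy, hnP]⟩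
  · rintro x hx ⟨y, hy⟩
    exact G.disjT x hx ⟨Hom.fT j y, by rw [← hqT, hy, hnT]⟩
  · rcases G.coverP (Hom.fP j' y) with ⟨x, hx⟩ | ⟨x, hx, h⟩
    · obtain ⟨z, rfl⟩ := hj.surjP x
      exact Or.inl ⟨z, hj'.strict.injP (by rw [hqP, hx])⟩
    · exact Or.inr ⟨x, hx, hj'.strict.injP (by rw [hnP, h])⟩
  · rcases G.coverT (Hom.fT j' y) with ⟨x, hx⟩ | ⟨x, hx, h⟩
    · have hxS : x ∉ S := fun h => (hj'.mem_range _).1 ⟨y, rfl⟩ ⟨x, h, hx⟩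
      obtain ⟨z, rfl⟩ := (hj.mem_range x).2 hxS
      exact Or.inl ⟨z, hj'.strict.injT (by rw [hqT, hx])⟩
    · exact Or.inr ⟨x, hx, hj'.strict.injT (by rw [hnT, h])⟩
  · rw [← hj'.strict.pname_eq, hnP, G.pname_eq x hx]
  · rw [← hj'.strict.tname_eq, hnT, G.tname_eq x hx]
  · rw [hj'.strict.marking_eq, hnP, G.marking_eq x hx]

/-- A step followed by a flattening along the residuals of `s` is a flattening along `s` and the
match of the step. -/
theorem cons {r : Match N} (hr : r.rule.IsTransitional) (hs : ∀ i, IsEmpty (s i).rule.K.T)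
    (st : Step r.rule r.occ M) (g : ∀ i, (s i).rule.L ⟶ st.D)
    (hg : ∀ i, g i ≫ st.toN = (s i).occ)
    (A : Flattening (fun i => (⟨(s i).rule, g i ≫ st.toM⟩ : Match M)) F) :
    Nonempty (Flattening (fun i : Option ι => i.elim r s) F) := by
  have C := st.isComplement hr
  have hM := st.toM_isStrict
  have G := isGluing_of_isPushout r.rule.r_strict st.po₂
  have hgT : ∀ i x, Hom.fT st.toN (Hom.fT (g i) x) = Hom.fT (s i).occ x :=
    fun i => congr_fT (hg i)
  -- The transitions still to be deleted, seen in the context of the first step; their images in `M`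
  -- are those deleted by `A`.
  let S : Set st.D.T := ⋃ i, Set.range (Hom.fT (g i))
  have hS : ⋃ i, Set.range (Hom.fT (g i ≫ st.toM)) = Hom.fT st.toM '' S := by
    rw [Set.image_iUnion]
    exact Set.iUnion_congr fun i => Set.range_comp (Hom.fT st.toM) (Hom.fT (g i))
  have CA : IsComplement A.d (Hom.fT st.toM '' S) := hS ▸ A.compl
  let j := st.D.removeTransitionsIncl S
  have hj : IsComplement j S := st.D.removeTransitionsIncl_isComplement S
  obtain ⟨q, hq⟩ := CA.exists_lift (j ≫ st.toM) (by
    rintro t ⟨x, hx, h⟩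
    exact (hj.mem_range _).1 ⟨t, rfl⟩ (hM.injT h ▸ hx))
  obtain ⟨n, hn⟩ := CA.exists_lift st.n (by
    rintro t ⟨x, -, h⟩
    exact G.disjT t (hr.notMem_range _ _) ⟨x, h⟩)
  obtain ⟨k₀, hk₀⟩ := hj.exists_lift st.k fun t => hr.isEmpty.elim t
  choose k hk using fun i => hj.exists_lift ((s i).rule.l ≫ g i) fun t => (hs i).elim t
  have PO := isGluing_complement st hj CA hk₀ hn hq
  have hkq : ∀ i, k i ≫ q = A.k i := fun i => A.compl.strict.cancel (by
    rw [Category.assoc, hq, ← Category.assoc, hk, A.k_d, Category.assoc])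
  exact ⟨{
    D := _
    d := j ≫ st.toN
    k := fun i => match i with
      | none => k₀
      | some i => k i
    a := q ≫ A.a
    b := fun i => match i with
      | none => n ≫ A.a
      | some i => A.b i
    disj := by
      rintro (_ | i) (_ | i') h x y hxy
      · exact h rfl
      · exact (C.mem_range _).1 ⟨_, hgT i' y⟩ ⟨x, hxy⟩
      · exact (C.mem_range _).1 ⟨_, hgT i x⟩ ⟨y, hxy.symm⟩
      · refine A.disj i i' (fun e => h (by rw [e])) x y (congrArg (Hom.fT st.toM) ?_)
        exact C.strict.injT ((hgT i x).trans (hxy.trans (hgT i' y).symm))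
    compl := by
      refine ⟨hj.strict.comp C.strict, C.surjP.comp hj.surjP, fun t => ⟨?_, fun h => ?_⟩⟩
      · rintro ⟨x, rfl⟩ h
        obtain ⟨_ | i, y, hy⟩ := Set.mem_iUnion.1 h
        · exact (C.mem_range _).1 ⟨_, rfl⟩ ⟨y, hy⟩
        · refine (hj.mem_range _).1 ⟨x, rfl⟩ (Set.mem_iUnion.2 ⟨i, y, C.strict.injT ?_⟩)
          exact (hgT i y).trans hy
      · obtain ⟨x, rfl⟩ := (C.mem_range t).2 fun h' => h (Set.mem_iUnion.2 ⟨none, h'⟩)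
        obtain ⟨y, rfl⟩ := (hj.mem_range x).2 fun h' => by
          obtain ⟨i, y, rfl⟩ := Set.mem_iUnion.1 h'
          exact h (Set.mem_iUnion.2 ⟨some i, y, (hgT i y).symm⟩)
        exact ⟨y, rfl⟩
    k_d := by
      rintro (_ | i)
      · change k₀ ≫ j ≫ st.toN = r.rule.l ≫ r.occ
        rw [← Category.assoc, hk₀, st.po₁.w]
      · change k i ≫ j ≫ st.toN = (s i).rule.l ≫ (s i).occ
        rw [← Category.assoc, hk, Category.assoc, hg]
    w := by
      rintro (_ | i)
      · change r.rule.r ≫ n ≫ A.a = k₀ ≫ q ≫ A.a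
        rw [← Category.assoc, PO.w, Category.assoc]
      · change (s i).rule.r ≫ A.b i = k i ≫ q ≫ A.a
        rw [← Category.assoc, hkq]
        exact A.w i
    exists_desc := fun h c hc => by
      obtain ⟨f, hnf, hqf⟩ := PO.exists_desc (c none) h (hc none)
      -- The colimit is built in two stages: the restricted pushout absorbs the right-hand side of
      -- `r`, then `A` absorbs the others.
      obtain ⟨f', haf, hbf⟩ := A.exists_desc f (fun i => c (some i)) fun i => by
        rw [← hkq, Category.assoc, hqf]
        exact hc (some i)
      refine ⟨f', by rw [Category.assoc, haf, hqf], ?_⟩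
      rintro (_ | i)
      · change (n ≫ A.a) ≫ f' = c none
        rw [Category.assoc, haf, hnf]
      · exact hbf i
    hom_ext := fun {X f f'} h hb => by
      refine A.hom_ext (PO.hom_ext ?_ ?_) fun i => hb (some i)
      · have := hb none
        change (n ≫ A.a) ≫ f = (n ≫ A.a) ≫ f' at this
        simpa only [Category.assoc] using this
      · simpa only [Category.assoc] using h }⟩

end Flattening

/-! ### Transformation sequences -/

section Sequence

variable {N M F F' : PTNet.{u} AP AT}

/-- Induction along the sequence: residuals keep their rules, so the tail is a flattening of `M`,
and `Flattening.cons` adds the first step. Indexing by list positions requires reindexing on both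
sides. -/
theorem TransSeq.nonempty_flattening {l : List (Match N)} (h : TransSeq N l F)
    (hl : ∀ s ∈ l, s.rule.IsTransitional) : Nonempty (Flattening l.get F) := by
  induction h with
  | nil e => exact ⟨Flattening.ofIsEmpty (ι := Fin 0) _ e⟩
  | @cons N M F s rest d rest' hres _ ih =>
    have hlen : rest.length = rest'.length := hres.length_eq
    let e := finCongr hlen
    have H : ∀ i, IsResidual d (rest.get i) (rest'.get (e i)) :=
      fun i => hres.get i.2 (e i).2
    choose g hg hgM using H
    obtain ⟨A⟩ := ih fun s' hs' => by
      obtain ⟨j, rfl⟩ := List.get_of_mem hs'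
      obtain ⟨i, rfl⟩ := e.surjective j
      rw [hgM]
      exact hl _ (List.mem_cons_of_mem _ (List.get_mem _ _))
    obtain ⟨B⟩ : Nonempty (Flattening (fun i => rest'.get (e i)) F) :=
      Flattening.reindex e.symm A
    rw [funext hgM] at B
    obtain ⟨B'⟩ := B.cons (hl _ List.mem_cons_self)
      (fun i => (hl _ (List.mem_cons_of_mem _ (List.get_mem _ _))).isEmpty) d g hg
    refine Flattening.reindex (finSuccEquiv rest.length).symm ?_
    have : (fun j => (s :: rest).get ((finSuccEquiv rest.length).symm j)) =
        fun i : Option (Fin rest.length) => i.elim s rest.get := by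
      funext i
      cases i <;> rfl
    exact this ▸ B'

theorem TransSeq.comp_iso {l : List (Match N)} (h : TransSeq N l F) (e : F ≅ F') :
    TransSeq N l F' := by
  induction h with
  | nil e' => exact .nil (e' ≪≫ e)
  | cons s rest d rest' hres _ ih => exact .cons s rest d rest' hres (ih e)

/-- The occurrence is injective on transitions and preserves their names. -/
structure Match.IsFaithful (s : Match N) : Prop where
  injT : Function.Injective (Hom.fT s.occ)
  tname_eq : ∀ t, N.tname (Hom.fT s.occ t) = s.rule.L.tname t

/-- The images of the occurrences have no transition in common. -/
def Match.DisjointTransitions (s s' : Match N) : Prop :=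
  ∀ x y, Hom.fT s.occ x ≠ Hom.fT s'.occ y

theorem exists_forall₂ {α β : Type*} {R : α → β → Prop} {l : List α}
    (h : ∀ a ∈ l, ∃ b, R a b) : ∃ l', List.Forall₂ R l l' := by
  induction l with
  | nil => exact ⟨[], .nil⟩
  | cons a l ih =>
    obtain ⟨b, hb⟩ := h a List.mem_cons_self
    obtain ⟨l', hl'⟩ := ih fun x hx => h x (List.mem_cons_of_mem _ hx)
    exact ⟨b :: l', .cons hb hl'⟩

theorem exists_mem_of_forall₂ {α β : Type*} {R : α → β → Prop} {l : List α} {l' : List β}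
    (h : List.Forall₂ R l l') {b : β} (hb : b ∈ l') : ∃ a ∈ l, R a b := by
  induction h with
  | nil => simp at hb
  | cons hab _ ih =>
    rcases List.mem_cons.1 hb with rfl | hb
    · exact ⟨_, List.mem_cons_self, hab⟩
    · obtain ⟨a, ha, h⟩ := ih hb
      exact ⟨a, List.mem_cons_of_mem _ ha, h⟩

theorem pairwise_of_forall₂ {α β : Type*} {R : α → β → Prop} {p : α → α → Prop}
    {q : β → β → Prop} (hpq : ∀ {a b a' b'}, R a a' → R b b' → p a b → q a' b')
    {l : List α} {l' : List β} (h : List.Forall₂ R l l') (hl : l.Pairwise p) :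
    l'.Pairwise q := by
  induction h with
  | nil => exact .nil
  | cons hab hrest ih =>
    rw [List.pairwise_cons] at hl
    refine .cons (fun b hb => ?_) (ih hl.2)
    obtain ⟨a, ha, h⟩ := exists_mem_of_forall₂ hrest hb
    exact hpq hab h (hl.1 a ha)

theorem exists_transSeq {N : PTNet.{u} AP AT} (l : List (Match N))
    (htr : ∀ s ∈ l, s.rule.IsTransitional) (hf : ∀ s ∈ l, s.IsFaithful)
    (hd : l.Pairwise Match.DisjointTransitions) : ∃ F, TransSeq N l F := by
  -- The residuals are matches in another net, so the induction is on the length with the net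
  -- varying.
  induction hn : l.length generalizing N with
  | zero =>
    obtain rfl := List.length_eq_zero_iff.1 hn
    exact ⟨N, .nil (Iso.refl N)⟩
  | succ n ih =>
    obtain _ | ⟨s, rest⟩ := l
    · simp at hn
    have hs := htr s List.mem_cons_self
    obtain ⟨M, ⟨d⟩⟩ := exists_step (o := s.occ) hs (hf s List.mem_cons_self).injT
      (hf s List.mem_cons_self).tname_eq
    have C := d.isComplement hs
    rw [List.pairwise_cons] at hd
    obtain ⟨rest', hres⟩ := exists_forall₂ (R := IsResidual d) (l := rest) fun x hx => by
      -- A later occurrence avoids the transitions deleted by `s`, hence factors through the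
      -- context.
      obtain ⟨g, hg⟩ := C.exists_lift x.occ (by
        rintro t ⟨y, hy⟩
        exact hd.1 x hx y t hy)
      exact ⟨_, g, hg, rfl⟩
    obtain ⟨F, hF⟩ := ih rest'
      (fun x hx => by
        obtain ⟨y, hy, g, hg, rfl⟩ := exists_mem_of_forall₂ hres hx
        exact htr y (List.mem_cons_of_mem _ hy))
      (fun x hx => by
        obtain ⟨y, hy, g, hg, rfl⟩ := exists_mem_of_forall₂ hres hx
        have hy := hf y (List.mem_cons_of_mem _ hy)
        have hgT : ∀ t, Hom.fT d.toN (Hom.fT g t) = Hom.fT y.occ t := congr_fT hg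
        refine ⟨fun a b hab => hy.injT ?_, fun t => ?_⟩
        · rw [← hgT, ← hgT, d.toM_isStrict.injT hab]
        · exact (d.toM_isStrict.tname_eq _).trans
            ((C.strict.tname_eq _).symm.trans ((congrArg N.tname (hgT t)).trans (hy.tname_eq t))))
      (pairwise_of_forall₂ (p := Match.DisjointTransitions) (by
        rintro a b _ _ ⟨g, hg, rfl⟩ ⟨g', hg', rfl⟩ hab x y hxy
        refine hab x y ?_
        have := d.toM_isStrict.injT hxy
        rw [← hg, ← hg', comp_fT, comp_fT, this]) hres hd.2)
      (by rw [← hres.length_eq]; simpa using hn)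
    exact ⟨F, .cons s rest d rest' hres hF⟩

end Sequence

/-! ### Finite coproducts and parallel rules -/

section Coproduct

variable {ι : Type u} [Finite ι]

/-- The coproduct of a finite family of nets. -/
noncomputable def sigmaNet (X : ι → PTNet.{u} AP AT) : PTNet.{u} AP AT where
  P := Σ i, (X i).P
  T := Σ i, (X i).T
  pre t := ((X t.1).pre t.2).mapDomain (Sigma.mk t.1)
  post t := ((X t.1).post t.2).mapDomain (Sigma.mk t.1)
  pname p := (X p.1).pname p.2
  tname t := (X t.1).tname t.2
  -- Finiteness of `ι` enters here: the total marking must have finite support.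
  marking := Finsupp.ofSupportFinite (fun p => (X p.1).marking p.2) (by
    refine (Set.finite_iUnion fun i =>
      ((X i).marking.support.finite_toSet.image (Sigma.mk i))).subset ?_
    rintro ⟨i, p⟩ h
    exact Set.mem_iUnion.2 ⟨i, p, Finsupp.mem_support_iff.2 h, rfl⟩)

/-- The coprojections of the coproduct. -/
noncomputable def sigmaIn (X : ι → PTNet.{u} AP AT) (i : ι) : X i ⟶ sigmaNet X :=
  ({ fP := fun p => (⟨i, p⟩ : Σ i, (X i).P)
     fT := fun t => (⟨i, t⟩ : Σ i, (X i).T)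
     pre_comm := fun _ => rfl
     post_comm := fun _ => rfl
     pname_le := fun _ => le_rfl
     tname_le := fun _ => le_rfl
     marking_le := fun _ => le_rfl } : Hom (X i) (sigmaNet X))

/-- The morphism out of the coproduct induced by a family of morphisms. -/
noncomputable def sigmaDesc {X : ι → PTNet.{u} AP AT} {Z : PTNet.{u} AP AT} (f : ∀ i, X i ⟶ Z) :
    sigmaNet X ⟶ Z :=
  ({ fP := fun p => Hom.fP (f p.1) p.2
     fT := fun t => Hom.fT (f t.1) t.2
     pre_comm := fun t => by
       refine ((f t.1).pre_comm t.2).trans ?_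
       exact Finsupp.mapDomain_comp (f := Sigma.mk t.1)
         (g := fun p : Σ i, (X i).P => Hom.fP (f p.1) p.2)
     post_comm := fun t => by
       refine ((f t.1).post_comm t.2).trans ?_
       exact Finsupp.mapDomain_comp (f := Sigma.mk t.1)
         (g := fun p : Σ i, (X i).P => Hom.fP (f p.1) p.2)
     pname_le := fun p => (f p.1).pname_le p.2
     tname_le := fun t => (f t.1).tname_le t.2
     marking_le := fun p => (f p.1).marking_le p.2 } : Hom (sigmaNet X) Z)

/-- The universal property of the coproduct. -/
noncomputable def sigmaIsColimit (X : ι → PTNet.{u} AP AT) :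
    Limits.IsColimit (Limits.Cofan.mk (sigmaNet X) (sigmaIn X)) :=
  Limits.Cofan.IsColimit.mk _ (fun c => sigmaDesc fun i => c.inj i) (fun _ _ => rfl)
    fun _ _ h => hom_ext (fun p => congr_fP (h p.1) p.2) fun t => congr_fT (h t.1) t.2

theorem exists_sigma_iso {X : ι → PTNet.{u} AP AT} {L : PTNet.{u} AP AT} {f : ∀ i, X i ⟶ L}
    (h : Limits.IsColimit (Limits.Cofan.mk L f)) :
    ∃ e : sigmaNet X ≅ L, ∀ i, sigmaIn X i ≫ e.hom = f i :=
  ⟨(sigmaIsColimit X).coconePointUniqueUpToIso h, fun i =>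
    (sigmaIsColimit X).comp_coconePointUniqueUpToIso_hom h ⟨i⟩⟩

theorem exists_place_of_isColimit {X : ι → PTNet.{u} AP AT} {L : PTNet.{u} AP AT}
    {f : ∀ i, X i ⟶ L} (h : Limits.IsColimit (Limits.Cofan.mk L f)) (p : L.P) :
    ∃ i x, Hom.fP (f i) x = p := by
  obtain ⟨e, he⟩ := exists_sigma_iso h
  refine ⟨(Hom.fP e.inv p).1, (Hom.fP e.inv p).2, ?_⟩
  rw [← he]
  exact fP_hom_inv e.symm p

theorem exists_transition_of_isColimit {X : ι → PTNet.{u} AP AT} {L : PTNet.{u} AP AT}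
    {f : ∀ i, X i ⟶ L} (h : Limits.IsColimit (Limits.Cofan.mk L f)) (t : L.T) :
    ∃ i x, Hom.fT (f i) x = t := by
  obtain ⟨e, he⟩ := exists_sigma_iso h
  refine ⟨(Hom.fT e.inv t).1, (Hom.fT e.inv t).2, ?_⟩
  rw [← he]
  exact fT_hom_inv e.symm t

theorem index_eq_of_isColimit {X : ι → PTNet.{u} AP AT} {L : PTNet.{u} AP AT}
    {f : ∀ i, X i ⟶ L} (h : Limits.IsColimit (Limits.Cofan.mk L f)) {i j : ι} {x : (X i).T}
    {y : (X j).T} (hxy : Hom.fT (f i) x = Hom.fT (f j) y) : i = j := by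
  obtain ⟨e, he⟩ := exists_sigma_iso h
  rw [← he, ← he] at hxy
  exact congrArg Sigma.fst ((isStrict_iso_hom e).injT hxy)

theorem sigmaDesc_isStrict {X Y : ι → PTNet.{u} AP AT} {f : ∀ i, X i ⟶ Y i}
    (hf : ∀ i, IsStrict (f i)) : IsStrict (sigmaDesc fun i => f i ≫ sigmaIn Y i) where
  injP := Function.Injective.sigma_map (β₂ := fun i => (Y i).P) (f₂ := fun i => Hom.fP (f i))
    Function.injective_id fun i => (hf i).injP
  injT := Function.Injective.sigma_map (β₂ := fun i => (Y i).T) (f₂ := fun i => Hom.fT (f i))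
    Function.injective_id fun i => (hf i).injT
  pname_eq p := (hf p.1).pname_eq p.2
  tname_eq t := (hf t.1).tname_eq t.2
  marking_eq p := (hf p.1).marking_eq p.2

/-- The parallel rule of a finite family of rules. -/
noncomputable def sigmaRule (σ : ι → Rule.{u} AP AT) : ParallelRule σ where
  rule :=
    { L := sigmaNet fun i => (σ i).L
      K := sigmaNet fun i => (σ i).K
      R := sigmaNet fun i => (σ i).R
      l := sigmaDesc fun i => (σ i).l ≫ sigmaIn (fun i => (σ i).L) i
      r := sigmaDesc fun i => (σ i).r ≫ sigmaIn (fun i => (σ i).R) i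
      l_strict := sigmaDesc_isStrict fun i => (σ i).l_strict
      r_strict := sigmaDesc_isStrict fun i => (σ i).r_strict }
  inL := sigmaIn _
  inK := sigmaIn _
  inR := sigmaIn _
  comm_l _ := rfl
  comm_r _ := rfl
  isColimitL := sigmaIsColimit _
  isColimitK := sigmaIsColimit _
  isColimitR := sigmaIsColimit _

theorem ParallelRule.isTransitional {σ : ι → Rule.{u} AP AT} (ρ : ParallelRule σ)
    (hσ : ∀ i, (σ i).IsTransitional) : ρ.rule.IsTransitional where
  surjP p := by
    obtain ⟨i, x, rfl⟩ := exists_place_of_isColimit ρ.isColimitL p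
    obtain ⟨y, rfl⟩ := (hσ i).surjP x
    exact ⟨Hom.fP (ρ.inK i) y, congr_fP (ρ.comm_l i) y⟩
  isEmpty := ⟨fun t => by
    obtain ⟨i, x, -⟩ := exists_transition_of_isColimit ρ.isColimitK t
    exact (hσ i).isEmpty.elim x⟩

variable {N F : PTNet.{u} AP AT} {s : ι → Match N}

/-- A morphism out of the coproduct of the right-hand sides is a family of morphisms, and
compatibility on the coproduct of the interfaces can be tested on each summand. The pushout property
of the step thus becomes that of a flattening. Disjointness follows since a step forces its
occurrence to be injective on transitions. -/
theorem ParallelStep.nonempty_flattening (hs : ∀ i, (s i).rule.IsTransitional)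
    (h : ParallelStep s F) : Nonempty (Flattening s F) := by
  obtain ⟨ρ, o, ho, ⟨st⟩⟩ := h
  have hρ := ρ.isTransitional hs
  have hoT : ∀ i x, Hom.fT o (Hom.fT (ρ.inL i) x) = Hom.fT (s i).occ x := fun i => congr_fT (ho i)
  have hrange : ⋃ i, Set.range (Hom.fT (s i).occ) = Set.range (Hom.fT o) := by
    ext t
    rw [Set.mem_iUnion]
    constructor
    · rintro ⟨i, x, rfl⟩
      exact ⟨_, hoT i x⟩
    · rintro ⟨y, rfl⟩
      obtain ⟨i, x, rfl⟩ := exists_transition_of_isColimit ρ.isColimitL y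
      exact ⟨i, x, (hoT i x).symm⟩
  exact ⟨{
    D := st.D
    d := st.toN
    k := fun i => ρ.inK i ≫ st.k
    a := st.toM
    b := fun i => ρ.inR i ≫ st.n
    disj := fun i j hij x y hxy => hij (index_eq_of_isColimit ρ.isColimitL (x := x) (y := y)
      (st.occ_injective hρ (by rw [hoT, hoT, hxy])))
    compl := hrange ▸ st.isComplement hρ
    k_d := fun i => by
      rw [Category.assoc, ← st.po₁.w, ← Category.assoc, ρ.comm_l, Category.assoc, ho]
    w := fun i => by
      rw [Category.assoc, ← st.po₂.w, ← Category.assoc, ← ρ.comm_r, Category.assoc]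
    exists_desc := fun h c hc => by
      let cR := Limits.Cofan.IsColimit.desc ρ.isColimitR c
      have hcR : ∀ i, ρ.inR i ≫ cR = c i := Limits.Cofan.IsColimit.fac ρ.isColimitR c
      have hw : ρ.rule.r ≫ cR = st.k ≫ h :=
        Limits.Cofan.IsColimit.hom_ext ρ.isColimitK _ _ fun i => by
          change ρ.inK i ≫ _ = ρ.inK i ≫ _
          rw [← Category.assoc, ρ.comm_r, Category.assoc, hcR, hc, Category.assoc]
      exact ⟨st.po₂.desc cR h hw, st.po₂.inr_desc _ _ _, fun i => by
        rw [Category.assoc, st.po₂.inl_desc, hcR]⟩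
    hom_ext := fun {X f g} h hb => st.po₂.hom_ext
      (Limits.Cofan.IsColimit.hom_ext ρ.isColimitR _ _ fun i => by
        change ρ.inR i ≫ _ = ρ.inR i ≫ _
        simpa only [Category.assoc] using hb i) h }⟩

theorem exists_parallelStep (hs : ∀ i, (s i).rule.IsTransitional) (hf : ∀ i, (s i).IsFaithful)
    (hd : ∀ i j, i ≠ j → (s i).DisjointTransitions (s j)) : ∃ F, ParallelStep s F := by
  let ρ := sigmaRule fun i => (s i).rule
  let o : ρ.rule.L ⟶ N := sigmaDesc fun i => (s i).occ
  obtain ⟨F, hF⟩ := exists_step (o := o) (ρ.isTransitional hs)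
    (by
      rintro ⟨i, x⟩ ⟨j, y⟩ h
      obtain rfl : i = j := by
        by_contra hij
        exact hd i j hij x y h
      exact congrArg (Sigma.mk i) ((hf i).injT h))
    fun t => (hf t.1).tname_eq t.2
  exact ⟨F, ρ, o, fun _ => rfl, hF⟩

end Coproduct

end PTNet

/-! ### Application to substitutions -/

namespace ReconfNet

open PTNet

variable {AP : Type v} {AT : Type w} [PartialOrder AP] [PartialOrder AT]
  [OrderTop AP] [OrderTop AT] {A : NameSpace AP AT} {N : PTNet.{u} AP AT} (RN : ReconfNet A N)

theorem substitution_isTransitional (t : RN.sT) : (RN.substitution t).rule.IsTransitional :=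
  ⟨fun p => ⟨p, rfl⟩, inferInstanceAs (IsEmpty PEmpty)⟩

theorem substitution_isFaithful (t : RN.sT) : (RN.substitution t).IsFaithful :=
  ⟨fun _ _ _ => rfl, fun _ => rfl⟩

theorem substitution_disjoint {t t' : RN.sT} (h : t ≠ t') :
    (RN.substitution t).DisjointTransitions (RN.substitution t') :=
  fun _ _ e => h (Subtype.ext e)

theorem substitution_injective : Function.Injective RN.substitution := fun t t' h => by
  have h := congrArg (fun s : Match N => Set.range (Hom.fT s.occ)) h
  have ht : t.1 ∈ Set.range (Hom.fT (RN.substitution t').occ) :=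
    h ▸ (⟨PUnit.unit, rfl⟩ : t.1 ∈ Set.range (Hom.fT (RN.substitution t).occ))
  obtain ⟨x, hx⟩ := ht
  exact Subtype.ext hx.symm

/-- A transformation sequence that applies all the substitutions ends in the flattening. -/
theorem nonempty_flattening_of_transSeq {l : List (Match N)} {F : PTNet.{u} AP AT}
    (hl : ∀ s, s ∈ l ↔ s ∈ RN.substitutions) (h : TransSeq N l F) :
    Nonempty (Flattening RN.substitution F) := by
  obtain ⟨B⟩ := h.nonempty_flattening fun s hs => by
    obtain ⟨t, rfl⟩ := (hl s).1 hs
    exact RN.substitution_isTransitional t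
  choose e he using fun i => (hl (l.get i)).1 (List.get_mem _ _)
  have hbij : Function.Bijective e := by
    refine ⟨fun i j hij => ?_, fun t => ?_⟩
    · by_contra hne
      -- No `Nodup` hypothesis is needed: the occurrences at distinct positions of a sequence that
      -- can be carried out are disjoint, so no substitution is applied twice.
      have hd := B.disj i j hne
      rw [← he, ← he, hij] at hd
      exact hd PUnit.unit PUnit.unit rfl
    · obtain ⟨i, hi⟩ := List.get_of_mem ((hl (RN.substitution t)).2 ⟨t, rfl⟩)
      exact ⟨i, RN.substitution_injective ((he i).trans hi)⟩
  refine Flattening.reindex (Equiv.ofBijective e hbij) ?_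
  have : (fun j => RN.substitution (Equiv.ofBijective e hbij j)) = l.get := funext he
  exact this ▸ B

end ReconfNet

theorem mainTheorem4 {AP : Type v} {AT : Type w} [PartialOrder AP] [PartialOrder AT]
    [OrderTop AP] [OrderTop AT] {A : NameSpace AP AT} {N : PTNet.{u} AP AT}
    (RN : ReconfNet A N) (hfin : RN.sT.Finite) :
    ∃ FLAT : PTNet.{u} AP AT,
      (∀ l : List (PTNet.Match N), l.Nodup → (∀ s, s ∈ l ↔ s ∈ RN.substitutions) →
        PTNet.TransSeq N l FLAT) ∧
      (∀ (l : List (PTNet.Match N)) (F : PTNet.{u} AP AT),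
        (∀ s, s ∈ l ↔ s ∈ RN.substitutions) → PTNet.TransSeq N l F → Nonempty (F ≅ FLAT)) ∧
      PTNet.ParallelStep RN.substitution FLAT ∧
      ∀ F : PTNet.{u} AP AT, PTNet.ParallelStep RN.substitution F → Nonempty (F ≅ FLAT) := by
  have : Finite RN.sT := hfin
  obtain ⟨FLAT, hFLAT⟩ := PTNet.exists_parallelStep RN.substitution_isTransitional
    RN.substitution_isFaithful fun _ _ => RN.substitution_disjoint
  -- The result of one parallel step serves as reference; every other result is a flattening along
  -- the same family and is compared with `B`.
  obtain ⟨B⟩ := hFLAT.nonempty_flattening RN.substitution_isTransitional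
  refine ⟨FLAT, fun l hnd hl => ?_, fun l F hl h => ?_, hFLAT, fun F h => ?_⟩
  · obtain ⟨F, hF⟩ := PTNet.exists_transSeq l
      (fun s hs => by
        obtain ⟨t, rfl⟩ := (hl s).1 hs
        exact RN.substitution_isTransitional t)
      (fun s hs => by
        obtain ⟨t, rfl⟩ := (hl s).1 hs
        exact RN.substitution_isFaithful t)
      (hnd.imp_of_mem fun {s s'} hs hs' hne => by
        obtain ⟨t, rfl⟩ := (hl s).1 hs
        obtain ⟨t', rfl⟩ := (hl s').1 hs'
        exact RN.substitution_disjoint fun e => hne (by rw [e]))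
    obtain ⟨B'⟩ := RN.nonempty_flattening_of_transSeq hl hF
    obtain ⟨e⟩ := B'.nonempty_iso B
    exact hF.comp_iso e
  · obtain ⟨B'⟩ := RN.nonempty_flattening_of_transSeq hl h
    exact B'.nonempty_iso B
  · obtain ⟨B'⟩ := h.nonempty_flattening RN.substitution_isTransitional
    exact B'.nonempty_iso B
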